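/- Let $G$ be a connected graph and $k$ a cardinal. In the Localization game with $k$ cops on $G$, the robber first chooses a vertex. In each round, each of the $k$ cops probes an arbitrary vertex of $G$ (the choices may depend on all earlier answers) and learns its distance to the robber; then the robber stays where he is or moves to a neighbouring vertex. After a cop move, a vertex is a candidate if it is the current position of some possible robber whose past positions are consistent with all distances returned so far. The cops win if they have a strategy that leads, against every robber, after finitely many rounds to a unique candidate. The localization number $\zeta(G)$ is the smallest cardinal $k$ such that $k$ cops have a winning strategy on $G$. A locally finite tree is an infinite tree in which every vertex has finite degree. Theorem. If $n$ is a positive integer or $n=\aleph_0$, then there is a locally finite tree $T$ with $\zeta(T)=n$. More precisely, the following graphs are locally finite trees with the stated localization numbers. 1. The ray $R$ (one-way infinite path) has $\zeta(R)=1$. 2. For every integer $n\ge 2$, let $S(n)$ be the graph obtained from the infinite rooted tree in which every vertex has $n(n-1)+1$ children by subdividing each edge $n-1$ times (that is, by replacing each edge with a path with $n-1$ internal vertices). Then $\zeta(S(n))=n$. 3. Let $T_\omega$ be the rooted tree in which every vertex at distance $i$ from the root has $i+1$ children, for each $i\ge 0$. Then $\zeta(T_\omega)=\aleph_0$. -/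

import Mathlib

open scoped Cardinal

namespace LocGame

universe u v

section Game

variable {V : Type u} {ι : Type v}

/-- The robber's positions `r 0, r 1, …` (`r t` is where the robber is when the cops make their
probes number `t`): he starts anywhere, and then stays or moves along an edge. -/
def IsRobberWalk (G : SimpleGraph V) (r : ℕ → V) : Prop :=
  ∀ t, r (t + 1) = r t ∨ G.Adj (r t) (r (t + 1))

/-- A strategy for a set of cops indexed by `ι`: it maps the distance vectors received so far
(latest first) to the vertices from which the cops probe next. -/
abbrev CopStrategy (V : Type u) (ι : Type v) : Type (max u v) :=
  List (ι → ℕ) → ι → V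

/-- The distance vectors (latest first) that the first `t` probing moves return when the cops play
`σ` and the robber's positions are `r`. -/
noncomputable def history (G : SimpleGraph V) (σ : CopStrategy V ι) (r : ℕ → V) :
    ℕ → List (ι → ℕ)
  | 0 => []
  | t + 1 => (fun i => G.dist (σ (history G σ r t) i) (r t)) :: history G σ r t

/-- The set of candidates after the cops' probes number `0, …, t`: the possible current positions
of a robber who would have produced the same distance vectors. -/
def candidates (G : SimpleGraph V) (σ : CopStrategy V ι) (r : ℕ → V) (t : ℕ) : Set V :=
  {x | ∃ r' : ℕ → V, IsRobberWalk G r' ∧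
    history G σ r' (t + 1) = history G σ r (t + 1) ∧ r' t = x}

/-- A set of cops indexed by `ι` wins the Localization game on `G`: some strategy leads, against
every robber, after finitely many rounds to a unique candidate. -/
def CopsWin (G : SimpleGraph V) (ι : Type v) : Prop :=
  ∃ σ : CopStrategy V ι, ∀ r : ℕ → V, IsRobberWalk G r → ∃ t : ℕ, candidates G σ r t = {r t}

/-- The localization number `ζ(G)`: the least cardinal `κ` such that `κ` cops win on `G`. -/
noncomputable def localizationNumber (G : SimpleGraph V) : Cardinal.{u} :=
  sInf {κ | ∃ ι : Type u, #ι = κ ∧ CopsWin G ι}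

/-- A locally finite tree: an infinite tree in which every vertex has finite degree. -/
def IsLocallyFiniteTree (G : SimpleGraph V) : Prop :=
  Infinite V ∧ G.IsTree ∧ ∀ v, (G.neighborSet v).Finite

end Game

section Trees

/-- `IsAddress c l`: the list `l` is the address of a vertex in the rooted tree in which each
vertex at depth `i` has `c i` children. The root is `[]`, and the children of `l` are the lists
`a :: l` with `a < c l.length`; so the depth of a vertex is the length of its address. -/
def IsAddress (c : ℕ → ℕ) : List ℕ → Prop
  | [] => True
  | a :: l => a < c l.length ∧ IsAddress c l

/-- The rooted tree in which each vertex at depth `i` has `c i` children; each vertex is joined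
to its children. -/
def rootedTree (c : ℕ → ℕ) : SimpleGraph {l : List ℕ // IsAddress c l} :=
  SimpleGraph.fromRel fun x y => ∃ a : ℕ, x.1 = a :: y.1

/-- The vertices of the tree obtained from `rootedTree c` by subdividing each edge `k` times.
The pair `(l, 0)` is the original vertex `l`. If `l` is not the root, then `(l, 1), …, (l, k)` are
the `k` new vertices on the edge between `l` and its parent, in the order from `l` to the
parent. -/
abbrev SubdividedVertex (c : ℕ → ℕ) (k : ℕ) : Type :=
  {p : List ℕ × ℕ // IsAddress c p.1 ∧ p.2 ≤ k ∧ (p.1 = [] → p.2 = 0)}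

/-- The tree obtained from `rootedTree c` by subdividing each edge `k` times: the edge between a
vertex `l` and its parent `m` becomes the path `(l, 0), (l, 1), …, (l, k), (m, 0)`. -/
def subdividedRootedTree (c : ℕ → ℕ) (k : ℕ) : SimpleGraph (SubdividedVertex c k) :=
  SimpleGraph.fromRel fun x y =>
    (y.1.1 = x.1.1 ∧ y.1.2 = x.1.2 + 1) ∨
      (x.1.2 = k ∧ y.1.2 = 0 ∧ ∃ a : ℕ, x.1.1 = a :: y.1.1)

/-- The ray (one-way infinite path) with vertices `0, 1, 2, …`. -/
def ray : SimpleGraph ℕ :=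
  SimpleGraph.fromRel fun i j => j = i + 1

/-- `S(n)`: the rooted tree in which every vertex has `n (n - 1) + 1` children, with each edge
subdivided `n - 1` times. -/
def treeS (n : ℕ) : SimpleGraph (SubdividedVertex (fun _ => n * (n - 1) + 1) (n - 1)) :=
  subdividedRootedTree (fun _ => n * (n - 1) + 1) (n - 1)

/-- `T_ω`: the rooted tree in which each vertex at depth `i` has `i + 1` children. -/
def treeOmega : SimpleGraph {l : List ℕ // IsAddress (fun i => i + 1) l} :=
  rootedTree fun i => i + 1

end Trees

end LocGame

namespace LocGame

universe u v

/-! ### Composing cop strategies, and the evasion principle for the robber -/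

section Strategies

variable {V : Type u} {ι : Type v} {G : SimpleGraph V}

/-! Lower bounds. Suppose that at least `L * k + 2` disjoint paths of length `L` leave a vertex `v`,
all but one of them leading to another vertex of this kind. While the robber runs along one of them,
`k` cops make `L * k` probes, and each probe spoils at most one path. On an unspoiled path every
probe returns its distance to `v` plus the number of steps run, so the answers do not depend on the
path: even adaptive probes are determined before the robber chooses. Two paths stay unspoiled, one
of them suitable for repeating the trick, and he is never located (`not_copsWin_of_forks`,
`IsRootedAt.not_copsWin`). In `S(n)` this works with `L = n` and fewer than `n` cops, in `T_ω` with
`L = 1` far from the root.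

Upper bound for `S(n)` (`IsRootedAt.copsWin`). A probe of the root bounds the robber's depth. Once
he is known to be below a hub, the cops probe the tops of `n` of its branches. The answers tell his
depth, and which probed branch he is in, if any. In a known branch he is either located, since the
branch is a path, or below the next hub, where the search restarts. Otherwise `n` branches are
excluded. After `n - 1` rounds only one branch is left. He gains at most `n - 1` levels meanwhile,
but the next hub is `n` levels deeper, so the bound on his depth relative to the hub drops. For
`T_ω`, which is countable, a cop on each vertex suffices. -/

theorem history_congr (σ : CopStrategy V ι) {r r' : ℕ → V} {t : ℕ} (h : ∀ s < t, r s = r' s) :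
    history G σ r t = history G σ r' t := by
  induction t with
  | zero => rfl
  | succ t ih =>
    simp only [history]
    rw [ih fun s hs => h s (by omega), h t (by omega)]

/-- The strategy `σ` locates every robber who is known to start in `S`. -/
def WinsFrom (G : SimpleGraph V) (σ : CopStrategy V ι) (S : Set V) : Prop :=
  ∀ r : ℕ → V, IsRobberWalk G r → r 0 ∈ S → ∃ t : ℕ, ∀ r' : ℕ → V, IsRobberWalk G r' → r' 0 ∈ S →
    history G σ r' (t + 1) = history G σ r (t + 1) → r' t = r t

theorem WinsFrom.mono {σ : CopStrategy V ι} {S S' : Set V} (h : WinsFrom G σ S) (hS : S' ⊆ S) :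
    WinsFrom G σ S' := fun r hr h0 =>
  (h r hr (hS h0)).imp fun _ ht r' hr' h0' => ht r' hr' (hS h0')

theorem WinsFrom.copsWin {σ : CopStrategy V ι} (h : WinsFrom G σ Set.univ) : CopsWin G ι := by
  refine ⟨σ, fun r hr => ?_⟩
  obtain ⟨t, ht⟩ := h r hr trivial
  refine ⟨t, Set.Subset.antisymm ?_ ?_⟩
  · rintro _ ⟨r', hr', hh, rfl⟩
    exact ht r' hr' trivial hh
  · rintro _ rfl
    exact ⟨r, hr, rfl, rfl⟩

/-- The vertices of `S` that return the distance vector `d` to the probes `p`. -/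
def answerSet (G : SimpleGraph V) (p : ι → V) (d : ι → ℕ) (S : Set V) : Set V :=
  {x ∈ S | (fun i => G.dist (p i) x) = d}

/-- The vertices that a robber in `S` may reach in one move. -/
def moveSet (G : SimpleGraph V) (S : Set V) : Set V :=
  {y | ∃ x ∈ S, y = x ∨ G.Adj x y}

/-- Strategies for all possible answers to a first probe combine into one strategy. -/
theorem exists_winsFrom_of_probe {S : Set V} (p : ι → V)
    (h : ∀ d : ι → ℕ, ¬ (answerSet G p d S).Subsingleton →
      ∃ σ : CopStrategy V ι, WinsFrom G σ (moveSet G (answerSet G p d S))) :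
    ∃ σ : CopStrategy V ι, WinsFrom G σ S := by
  have h' : ∀ d : ι → ℕ, ∃ σ : CopStrategy V ι, ¬ (answerSet G p d S).Subsingleton →
      WinsFrom G σ (moveSet G (answerSet G p d S)) := fun d => by
    by_cases hd : (answerSet G p d S).Subsingleton
    · exact ⟨fun _ => p, fun hn => absurd hd hn⟩
    · exact (h d hd).imp fun _ hσ _ => hσ
  choose σ' hσ' using h'
  -- Histories list the latest answer first, so the answer to the first probe is the last entry. It
  -- selects the strategy, which sees only the later answers.
  let σ : CopStrategy V ι := fun l =>
    match l.getLast? with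
    | none => p
    | some d => σ' d l.dropLast
  have hist : ∀ (r : ℕ → V) (t : ℕ), history G σ r (t + 1) =
      history G (σ' fun i => G.dist (p i) (r 0)) (fun s => r (s + 1)) t ++
        [fun i => G.dist (p i) (r 0)] := by
    intro r t
    induction t with
    | zero => rfl
    | succ t ih =>
      rw [history, ih]
      simp [σ, history]
  refine ⟨σ, fun r hr h0 => ?_⟩
  by_cases hd : (answerSet G p (fun i => G.dist (p i) (r 0)) S).Subsingleton
  · refine ⟨0, fun r' _ h0' hh => hd ⟨h0', ?_⟩ ⟨h0, rfl⟩⟩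
    rw [hist, hist] at hh
    simpa [history] using hh
  · obtain ⟨t, ht⟩ := hσ' _ hd (fun s => r (s + 1)) (fun s => hr (s + 1)) ⟨r 0, ⟨h0, rfl⟩, hr 0⟩
    refine ⟨t + 1, fun r' hr' h0' hh => ?_⟩
    rw [hist, hist] at hh
    obtain ⟨h1, h2⟩ := List.append_inj' hh rfl
    have h2' : (fun i => G.dist (p i) (r' 0)) = fun i => G.dist (p i) (r 0) := by simpa using h2
    rw [h2'] at h1
    exact ht (fun s => r' (s + 1)) (fun s => hr' (s + 1)) ⟨r' 0, ⟨h0', h2'⟩, hr' 0⟩ h1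

/-- The distance vectors returned by a robber who moves straight away from `v` and from all
probes, if `h` has been returned before. -/
noncomputable def runHistory (G : SimpleGraph V) (σ : CopStrategy V ι) (v : V)
    (h : List (ι → ℕ)) : ℕ → List (ι → ℕ)
  | 0 => h
  | j + 1 => (fun i => G.dist (σ (runHistory G σ v h j) i) v + (j + 1)) :: runHistory G σ v h j

/-- If from each vertex in `A` the robber always has two disjoint paths of length `L` that no
probes distinguish, one of them leading back to `A`, then he is never located. -/
theorem not_copsWin_of_forks {L : ℕ} (hL : 0 < L) (A : Set V) (hne : A.Nonempty)
    (hA : ∀ v ∈ A, ∀ q : ℕ → ι → V, ∃ a b : ℕ → V, a 0 = v ∧ b 0 = v ∧ a L ∈ A ∧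
      ∀ j < L, G.Adj (a j) (a (j + 1)) ∧ G.Adj (b j) (b (j + 1)) ∧ a (j + 1) ≠ b (j + 1) ∧
        ∀ i, G.dist (q j i) (a (j + 1)) = G.dist (q j i) v + (j + 1) ∧
          G.dist (q j i) (b (j + 1)) = G.dist (q j i) v + (j + 1)) :
    ¬ CopsWin G ι := by
  rintro ⟨σ, hσ⟩
  obtain ⟨v₀, h₀⟩ := hne
  have hA' : ∀ s : A × List (ι → ℕ), ∃ a b : ℕ → V, a 0 = s.1 ∧ b 0 = s.1 ∧ a L ∈ A ∧
      ∀ j < L, G.Adj (a j) (a (j + 1)) ∧ G.Adj (b j) (b (j + 1)) ∧ a (j + 1) ≠ b (j + 1) ∧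
        ∀ i, G.dist (σ (runHistory G σ s.1 s.2 j) i) (a (j + 1)) =
            G.dist (σ (runHistory G σ s.1 s.2 j) i) s.1 + (j + 1) ∧
          G.dist (σ (runHistory G σ s.1 s.2 j) i) (b (j + 1)) =
            G.dist (σ (runHistory G σ s.1 s.2 j) i) s.1 + (j + 1) :=
    fun s => hA s.1 s.1.2 fun j => σ (runHistory G σ s.1 s.2 j)
  choose a b ha0 hb0 haL hab using hA'
  -- Time is cut into blocks of length `L`. The state `s m` is the fork vertex and the history
  -- before block `m`.
  let s : ℕ → A × List (ι → ℕ) := fun m => Nat.rec (⟨v₀, h₀⟩, [])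
    (fun _ s => (⟨a s L, haL s⟩, runHistory G σ s.1 s.2 L)) m
  have hs1 : ∀ m, ((s (m + 1)).1 : V) = a (s m) L := fun _ => rfl
  have hs2 : ∀ m, (s (m + 1)).2 = runHistory G σ (s m).1 (s m).2 L := fun _ => rfl
  -- The `+ 1` puts the robber one step past the fork vertex at the first probe of a block, and on
  -- the next fork vertex at the last.
  let r : ℕ → V := fun t => a (s (t / L)) (t % L + 1)
  have hr : ∀ m j, j < L → r (m * L + j) = a (s m) (j + 1) := by
    intro m j hj
    simp only [r]
    rw [Nat.mul_comm m L, Nat.mul_add_div hL, Nat.mul_add_mod, Nat.div_eq_of_lt hj,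
      Nat.mod_eq_of_lt hj, Nat.add_zero]
  have split : ∀ t, ∃ m j, j < L ∧ t = m * L + j := fun t =>
    ⟨t / L, t % L, Nat.mod_lt _ hL, by rw [Nat.mul_comm]; exact (Nat.div_add_mod t L).symm⟩
  have last : ∀ m, r (m * L + (L - 1)) = (s (m + 1)).1 := fun m => by
    rw [hr m _ (by omega), hs1, Nat.sub_add_cancel hL]
  have walk : IsRobberWalk G r := by
    intro t
    right
    obtain ⟨m, j, hj, rfl⟩ := split t
    by_cases hj' : j + 1 < L
    · rw [Nat.add_assoc, hr m j hj, hr m (j + 1) hj']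
      exact (hab (s m) _ hj').1
    · obtain rfl : j = L - 1 := by omega
      rw [last, show m * L + (L - 1) + 1 = (m + 1) * L + 0 by rw [Nat.add_mul]; omega,
        hr (m + 1) 0 hL, ← ha0]
      exact (hab (s (m + 1)) 0 hL).1
  have hist_step : ∀ (x : ℕ → V) (m j : ℕ), j < L →
      (x (m * L + j) = a (s m) (j + 1) ∨ x (m * L + j) = b (s m) (j + 1)) →
      history G σ x (m * L + j) = runHistory G σ (s m).1 (s m).2 j →
      history G σ x (m * L + (j + 1)) = runHistory G σ (s m).1 (s m).2 (j + 1) := by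
    intro x m j hj hx hh
    rw [← Nat.add_assoc, history, hh, runHistory]
    congr 1
    funext i
    rcases hx with hx | hx
    · rw [hx, ((hab (s m) j hj).2.2.2 i).1]
    · rw [hx, ((hab (s m) j hj).2.2.2 i).2]
  have hist_block : ∀ (x : ℕ → V) (m : ℕ),
      (∀ j < L, x (m * L + j) = a (s m) (j + 1) ∨ x (m * L + j) = b (s m) (j + 1)) →
      history G σ x (m * L) = (s m).2 →
      ∀ j ≤ L, history G σ x (m * L + j) = runHistory G σ (s m).1 (s m).2 j := by
    intro x m hx hh j
    induction j with
    | zero => exact fun _ => hh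
    | succ j ih => exact fun hj => hist_step x m j hj (hx j hj) (ih (by omega))
  have hist0 : ∀ m, history G σ r (m * L) = (s m).2 := by
    intro m
    induction m with
    | zero => rw [Nat.zero_mul]; rfl
    | succ m ih =>
      rw [Nat.add_mul, Nat.one_mul, hs2]
      exact hist_block r m (fun j hj => .inl (hr m j hj)) ih L le_rfl
  obtain ⟨t, ht⟩ := hσ r walk
  obtain ⟨m, j, hj, rfl⟩ := split t
  -- The decoy follows `r` up to block `m`, takes the other path there, and then rests at its end
  -- (hence the `min`).
  let r' : ℕ → V := fun k => if k < m * L then r k else b (s m) (min (k - m * L) (L - 1) + 1)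
  have hr' : ∀ j < L, r' (m * L + j) = b (s m) (j + 1) := by
    intro j hj
    simp only [r']
    rw [if_neg (by omega), Nat.add_sub_cancel_left, min_eq_left (by omega)]
  have walk' : IsRobberWalk G r' := by
    intro k
    simp only [r']
    by_cases h1 : k + 1 < m * L
    · rw [if_pos h1, if_pos (by omega)]
      exact walk k
    · rw [if_neg h1]
      by_cases h2 : k < m * L
      · rw [if_pos h2]
        right
        obtain ⟨m, rfl⟩ : ∃ m', m = m' + 1 := by
          rcases m with _ | m
          · simp at h2
          · exact ⟨m, rfl⟩
        rw [Nat.add_mul] at h1 h2 ⊢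
        obtain rfl : k = m * L + (L - 1) := by omega
        rw [last, ← hb0, show m * L + (L - 1) + 1 - (m * L + 1 * L) = 0 by omega]
        simpa using (hab (s (m + 1)) 0 hL).2.1
      · rw [if_neg h2]
        by_cases h3 : k - m * L < L - 1
        · right
          rw [min_eq_left (by omega), min_eq_left (by omega), Nat.sub_add_comm (by omega)]
          exact (hab (s m) (k - m * L + 1) (by omega)).2.1
        · left
          rw [min_eq_right (by omega), min_eq_right (by omega)]
  have mem : b (s m) (j + 1) ∈ candidates G σ r (m * L + j) := by
    refine ⟨r', walk', ?_, hr' j hj⟩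
    rw [Nat.add_assoc, hist_block r m (fun j hj => .inl (hr m j hj)) (hist0 m) _ hj,
      hist_block r' m (fun j hj => .inr (hr' j hj)) ?_ _ hj]
    rw [← hist0 m]
    exact history_congr σ fun k hk => if_pos hk
  rw [ht, Set.mem_singleton_iff, hr m j hj] at mem
  exact (hab (s m) j hj).2.2.1 mem.symm

theorem copsWin_self (hG : G.Connected) : CopsWin G V := by
  refine ⟨fun _ => id, fun r hr => ⟨0, Set.Subset.antisymm ?_ ?_⟩⟩
  · rintro _ ⟨r', -, hh, rfl⟩
    simp only [history, id, List.cons.injEq, and_true] at hh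
    have := congrFun hh (r 0)
    rw [SimpleGraph.dist_self, hG.dist_eq_zero_iff] at this
    exact this.symm
  · rintro _ rfl
    exact ⟨r, hr, rfl, rfl⟩

/-- Without cops all histories of a given length coincide, so two robbers resting at different
vertices are never told apart. This is the lower bound for the ray. -/
theorem CopsWin.nonempty [Nontrivial V] (h : CopsWin G ι) : Nonempty ι := by
  by_contra hι
  rw [not_nonempty_iff] at hι
  obtain ⟨σ, hσ⟩ := h
  obtain ⟨x, y, hxy⟩ := exists_pair_ne V
  obtain ⟨t, ht⟩ := hσ (fun _ => x) fun _ => .inl rfl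
  have hist : ∀ t, history G σ (fun _ => y) t = history G σ (fun _ => x) t := by
    intro t
    induction t with
    | zero => rfl
    | succ t ih =>
      rw [history, history, ih]
      congr 1
      exact Subsingleton.elim _ _
  have : y ∈ candidates G σ (fun _ => x) t := ⟨fun _ => y, fun _ => .inl rfl, hist _, rfl⟩
  rw [ht] at this
  exact hxy this.symm

end Strategies

theorem localizationNumber_eq {V : Type u} {G : SimpleGraph V} {κ : Cardinal.{u}} {ι : Type u}
    (hι : #ι = κ) (hwin : CopsWin G ι) (hmin : ∀ ι' : Type u, CopsWin G ι' → κ ≤ #ι') :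
    localizationNumber G = κ := by
  refine le_antisymm (csInf_le' ⟨ι, hι, hwin⟩) (le_csInf ⟨κ, ι, hι, hwin⟩ ?_)
  rintro _ ⟨ι', rfl, h⟩
  exact hmin ι' h

/-! ### Rooted trees: descendants, bridges and distances -/

section Rooted

variable {V : Type u} {G : SimpleGraph V} {root : V} {par : V → V} {depth : V → ℕ}

/-- The edges of `G` join the vertices other than `root` to their parents. -/
structure IsRootedAt (G : SimpleGraph V) (root : V) (par : V → V) (depth : V → ℕ) : Prop where
  depth_root : depth root = 0
  depth_eq : ∀ x, x ≠ root → depth x = depth (par x) + 1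
  adj_iff : ∀ x y, G.Adj x y ↔ (x ≠ root ∧ par x = y) ∨ (y ≠ root ∧ par y = x)

/-- `Below root par u x`: the vertex `x` is `u` or a descendant of `u`. -/
inductive Below (root : V) (par : V → V) (u : V) : V → Prop
  | refl : Below root par u u
  | child {x : V} (hx : x ≠ root) (h : Below root par u (par x)) : Below root par u x

theorem Below.trans {u v x : V} (h : Below root par u v) (h' : Below root par v x) :
    Below root par u x := by
  induction h' with
  | refl => exact h
  | child hx _ ih => exact .child hx ih

theorem Below.exists_child {v x : V} (h : Below root par v x) (hne : x ≠ v) :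
    ∃ u, u ≠ root ∧ par u = v ∧ Below root par u x := by
  induction h with
  | refl => exact absurd rfl hne
  | @child x hx h ih =>
    by_cases hp : par x = v
    · exact ⟨x, hx, hp, .refl⟩
    · obtain ⟨u, h1, h2, h3⟩ := ih hp
      exact ⟨u, h1, h2, .child hx h3⟩

namespace IsRootedAt

variable (hT : IsRootedAt G root par depth)
include hT

theorem depth_le {u x : V} (h : Below root par u x) : depth u ≤ depth x := by
  induction h with
  | refl => exact le_rfl
  | child hx _ ih => have := hT.depth_eq _ hx; omega

theorem eq_of_below {u x : V} (h : Below root par u x) (hd : depth x ≤ depth u) : x = u := by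
  cases h with
  | refl => rfl
  | child hx h => have := hT.depth_le h; have := hT.depth_eq _ hx; omega

/-- The ancestors of a vertex form a chain with one member at each depth. Hence different branches
at a vertex are disjoint. -/
theorem below_unique {u u' x : V} (h : Below root par u x) (h' : Below root par u' x)
    (hd : depth u = depth u') : u = u' := by
  induction h with
  | refl => exact hT.eq_of_below h' hd.le
  | child hx h ih =>
    cases h' with
    | refl => have := hT.depth_le h; have := hT.depth_eq _ hx; omega
    | child _ h' => exact ih h'

theorem root_below (x : V) : Below root par root x := by
  induction hn : depth x generalizing x with
  | zero =>
    by_cases hx : x = root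
    · exact hx ▸ .refl
    · have := hT.depth_eq _ hx; omega
  | succ n ih =>
    by_cases hx : x = root
    · exact hx ▸ .refl
    · exact .child hx (ih _ (by have := hT.depth_eq _ hx; omega))

theorem ne_root_of_depth_pos {x : V} (h : 0 < depth x) : x ≠ root := by
  rintro rfl
  exact h.ne' hT.depth_root

theorem adj_par {x : V} (hx : x ≠ root) : G.Adj (par x) x := (hT.adj_iff _ _).2 (.inr ⟨hx, rfl⟩)

theorem depth_le_of_adj {x y : V} (h : G.Adj x y) : depth y ≤ depth x + 1 := by
  rcases (hT.adj_iff x y).1 h with ⟨hx, rfl⟩ | ⟨hy, rfl⟩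
  · have := hT.depth_eq _ hx; omega
  · exact (hT.depth_eq _ hy).le

/-- The edge from `u` to its parent is the only one that leaves the part below `u`. The bridge
argument, the distance formula and the confinement of the robber all rest on this. -/
theorem eq_of_adj_of_below {u x y : V} (h : G.Adj x y) (hx : ¬ Below root par u x)
    (hy : Below root par u y) : y = u ∧ x = par u ∧ u ≠ root := by
  rcases (hT.adj_iff x y).1 h with ⟨hx', rfl⟩ | ⟨hy', rfl⟩
  · exact absurd (.child hx' hy) hx
  · cases hy with
    | refl => exact ⟨rfl, rfl, hy'⟩
    | child _ hy => exact absurd hy hx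

theorem below_of_adj {v x y : V} (h : G.Adj x y) (hx : Below root par v x) (hne : x ≠ v) :
    Below root par v y := by
  by_contra hy
  exact hne (hT.eq_of_adj_of_below h.symm hy hx).1

theorem reachable {u x : V} (h : Below root par u x) : G.Reachable u x := by
  induction h with
  | refl => exact .refl _
  | child hx _ ih => exact ih.trans (hT.adj_par hx).reachable

theorem connected : G.Connected :=
  (SimpleGraph.connected_iff_exists_forall_reachable G).2
    ⟨root, fun x => hT.reachable (hT.root_below x)⟩

theorem isTree : G.IsTree := by
  refine ⟨hT.connected, SimpleGraph.isAcyclic_iff_forall_adj_isBridge.2 ?_⟩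
  have key : ∀ u, u ≠ root → G.IsBridge s(u, par u) := by
    intro u hu
    rw [SimpleGraph.isBridge_iff]
    rintro ⟨w⟩
    have : ∀ x y, (G.deleteEdges {s(u, par u)}).Walk x y →
        Below root par u x → Below root par u y := by
      intro x y w
      induction w with
      | nil => exact id
      | @cons x y z h _ ih =>
        intro hx
        apply ih
        by_contra hy
        rw [SimpleGraph.deleteEdges_adj] at h
        obtain ⟨h1, h2, -⟩ := hT.eq_of_adj_of_below h.1.symm hy hx
        exact h.2 (by rw [h1, h2]; rfl)
    have h := hT.depth_le (this _ _ w .refl)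
    have := hT.depth_eq _ hu
    omega
  intro x y h
  rcases (hT.adj_iff x y).1 h with ⟨hx, rfl⟩ | ⟨hy, rfl⟩
  · exact key x hx
  · rw [Sym2.eq_swap]
    exact key y hy

theorem isLocallyFiniteTree [Infinite V] (hfin : ∀ v, {u | u ≠ root ∧ par u = v}.Finite) :
    IsLocallyFiniteTree G := by
  refine ⟨inferInstance, hT.isTree, fun v => ((Set.finite_singleton (par v)).union (hfin v)).subset ?_⟩
  intro y hy
  rcases (hT.adj_iff v y).1 hy with ⟨-, h⟩ | h
  · exact .inl h.symm
  · exact .inr h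

end IsRootedAt

/-- Summing along a geodesic. This turns potentials that grow by at most one per edge into lower
bounds on distances. -/
theorem le_add_dist (hG : G.Connected) {f : V → ℤ} (hf : ∀ x y, G.Adj x y → f y ≤ f x + 1)
    (x y : V) : f y ≤ f x + G.dist x y := by
  obtain ⟨w, hw⟩ := hG.exists_walk_length_eq_dist x y
  rw [← hw]
  clear hw
  induction w with
  | nil => simp
  | cons h _ ih => have := hf _ _ h; push_cast [SimpleGraph.Walk.length_cons]; omega

namespace IsRootedAt

variable (hT : IsRootedAt G root par depth)
include hT

theorem dist_add_depth_le {u x : V} (h : Below root par u x) :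
    G.dist u x + depth u ≤ depth x := by
  induction h with
  | refl => simp
  | @child x hx _ ih =>
    have := hT.depth_eq _ hx
    have h1 := hT.connected.dist_triangle (u := u) (v := par x) (w := x)
    rw [SimpleGraph.dist_eq_one_iff_adj.2 (hT.adj_par hx)] at h1
    omega

theorem dist_add_depth {u x : V} (h : Below root par u x) : G.dist u x + depth u = depth x := by
  refine (hT.dist_add_depth_le h).antisymm ?_
  have := le_add_dist hT.connected (f := fun x => (depth x : ℤ))
    (fun x y h => by exact_mod_cast hT.depth_le_of_adj h) u x
  omega

/-- A path that enters the part below `u` passes through the parent of `u`. -/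
theorem dist_add_depth_par {p u x : V} (hu : u ≠ root) (hp : ¬ Below root par u p)
    (hx : Below root par u x) : G.dist p x + depth (par u) = G.dist p (par u) + depth x := by
  classical
  have hd := hT.depth_eq _ hu
  have hdx := hT.depth_le hx
  have upper : G.dist p x ≤ G.dist p (par u) + G.dist (par u) x := hT.connected.dist_triangle
  have := hT.dist_add_depth ((Below.child hu .refl).trans hx)
  -- The potential is the distance from `p` outside the part below `u` and the claimed formula
  -- inside. Only the edge from `u` to its parent joins the two regions, and there the definitions
  -- fit.
  let f : V → ℤ := fun y =>
    if Below root par u y then G.dist p (par u) + depth y - depth (par u) else G.dist p y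
  have hf : ∀ x y, G.Adj x y → f y ≤ f x + 1 := by
    intro y z hyz
    have hyz1 : G.dist y z = 1 := SimpleGraph.dist_eq_one_iff_adj.2 hyz
    simp only [f]
    split_ifs with h1 h2 h2
    · have := hT.depth_le_of_adj hyz; omega
    · obtain ⟨rfl, rfl, -⟩ := hT.eq_of_adj_of_below hyz h2 h1
      omega
    · obtain ⟨rfl, rfl, -⟩ := hT.eq_of_adj_of_below hyz.symm h1 h2
      omega
    · have := hT.connected.dist_triangle (u := p) (v := y) (w := z)
      omega
  have lower := le_add_dist hT.connected hf p x
  simp only [f, if_pos hx, if_neg hp, SimpleGraph.dist_self] at lower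
  omega

theorem iterate_par {x : V} {j : ℕ} (hj : j ≤ depth x) :
    Below root par (par^[j] x) x ∧ depth (par^[j] x) + j = depth x := by
  induction j with
  | zero => exact ⟨.refl, rfl⟩
  | succ j ih =>
    obtain ⟨h1, h2⟩ := ih (by omega)
    have hne : par^[j] x ≠ root := hT.ne_root_of_depth_pos (by omega)
    have := hT.depth_eq _ hne
    rw [Function.iterate_succ_apply']
    exact ⟨(Below.child hne .refl).trans h1, by omega⟩

end IsRootedAt

end Rooted

/-! ### The counting lower bound and the search strategy -/

section Bounds

variable {V : Type u} {ι : Type v} {G : SimpleGraph V} {root : V} {par : V → V} {depth : V → ℕ}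

/-- If each of `N` probes hits at most one of at least `N + 2` branches, then two branches are not
hit. -/
theorem exists_two_not_hit {α β : Type*} [Fintype α] [Fintype β] (hit : α → β → Prop)
    (huniq : ∀ a b b', hit a b → hit a b' → b = b')
    (hcard : Fintype.card α + 2 ≤ Fintype.card β) :
    ∃ b b', b ≠ b' ∧ (∀ a, ¬ hit a b) ∧ ∀ a, ¬ hit a b' := by
  classical
  have h1 : (Finset.univ.filter fun b => ∃ a, hit a b).card ≤ Fintype.card α := by
    -- `none` is the default for branches that are not hit, as `α` may be empty.
    have : ∀ b : β, ∃ a : Option α, (∃ a, hit a b) → ∃ a', a = some a' ∧ hit a' b := fun b => by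
      by_cases h : ∃ a, hit a b
      · obtain ⟨a, ha⟩ := h
        exact ⟨some a, fun _ => ⟨a, rfl, ha⟩⟩
      · exact ⟨none, fun h' => absurd h' h⟩
    choose f hf using this
    have hsub : (Finset.univ.filter fun b => ∃ a, hit a b).card ≤
        (Finset.univ.map (Function.Embedding.some (α := α))).card := by
      refine Finset.card_le_card_of_injOn f ?_ ?_
      · intro b hb
        obtain ⟨a, ha, -⟩ := hf b (Finset.mem_filter.1 hb).2
        simp [ha]
      · intro b hb b' hb' hbb
        obtain ⟨a, ha, hh⟩ := hf b (Finset.mem_filter.1 hb).2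
        obtain ⟨a', ha', hh'⟩ := hf b' (Finset.mem_filter.1 hb').2
        rw [ha, ha', Option.some_inj] at hbb
        subst hbb
        exact huniq _ _ _ hh hh'
    rwa [Finset.card_map, Finset.card_univ] at hsub
  have h2 := Finset.card_filter_add_card_filter_not (s := (Finset.univ : Finset β))
    (p := fun b => ∃ a, hit a b)
  rw [Finset.card_univ] at h2
  obtain ⟨b, hb, b', hb', hne⟩ := Finset.one_lt_card.1
    (show 1 < (Finset.univ.filter fun b => ¬ ∃ a, hit a b).card by omega)
  exact ⟨b, b', hne, not_exists.1 (Finset.mem_filter.1 hb).2,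
    not_exists.1 (Finset.mem_filter.1 hb').2⟩

/-- If below each vertex of `A` there are at least `L * k + 1` disjoint paths of length `L` back to
`A`, then `k` cops do not win. -/
theorem IsRootedAt.not_copsWin [Fintype ι] (hT : IsRootedAt G root par depth) {L m : ℕ}
    (hL : 0 < L) (hm : L * Fintype.card ι + 1 ≤ m) (A : Set V) (hne : A.Nonempty)
    (hA : ∀ v ∈ A, L ≤ depth v ∧ ∃ w : Fin m → V, Function.Injective (fun a => par^[L - 1] (w a)) ∧
      ∀ a, w a ∈ A ∧ par^[L] (w a) = v ∧ depth (w a) = depth v + L) :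
    ¬ CopsWin G ι := by
  refine not_copsWin_of_forks hL A hne fun v hv q => ?_
  obtain ⟨hLv, w, hinj, hw⟩ := hA v hv
  let top : Fin m → V := fun a => par^[L - 1] (w a)
  have top_depth : ∀ a, depth (top a) = depth v + 1 := fun a => by
    have := (hT.iterate_par (x := w a) (j := L - 1) (by rw [(hw a).2.2]; omega)).2
    simp only [top]
    rw [(hw a).2.2] at this
    omega
  have top_ne : ∀ a, top a ≠ root := fun a => hT.ne_root_of_depth_pos (by rw [top_depth]; omega)
  have top_par : ∀ a, par (top a) = v := fun a => by
    have h := (hw a).2.1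
    rwa [show L = (L - 1) + 1 by omega, Function.iterate_succ_apply'] at h
  -- `none` is the path towards the root, `some a` the path down to `w a`.
  let pos : Option (Fin m) → ℕ → V := fun b j =>
    match b with
    | none => par^[j] v
    | some a => par^[L - j] (w a)
  -- A probe hits the branch that contains it. A probe of `v` itself hits none.
  let hit : V → Option (Fin m) → Prop := fun p b =>
    match b with
    | none => ¬ Below root par v p
    | some a => Below root par (top a) p
  have below_top : ∀ a j, j < L → Below root par (top a) (par^[L - (j + 1)] (w a)) := by
    intro a j hj
    have := (hT.iterate_par (x := par^[L - (j + 1)] (w a)) (j := j) (by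
      have := (hT.iterate_par (x := w a) (j := L - (j + 1)) (by rw [(hw a).2.2]; omega)).2
      rw [(hw a).2.2] at this; omega)).1
    rwa [← Function.iterate_add_apply, show j + (L - (j + 1)) = L - 1 by omega] at this
  have pos_depth : ∀ a j, j ≤ L → depth (par^[L - j] (w a)) = depth v + j := by
    intro a j hj
    have := (hT.iterate_par (x := w a) (j := L - j) (by rw [(hw a).2.2]; omega)).2
    rw [(hw a).2.2] at this
    omega
  have hit_uniq : ∀ p b b', hit p b → hit p b' → b = b' := by
    have hbv : ∀ p a, Below root par (top a) p → Below root par v p := fun p a h =>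
      (Below.child (top_ne a) (by rw [top_par]; exact .refl)).trans h
    rintro p (_ | a) (_ | a') h h'
    · rfl
    · exact absurd (hbv _ _ h') h
    · exact absurd (hbv _ _ h) h'
    · exact congrArg some (hinj (hT.below_unique h h' (by rw [top_depth, top_depth])))
  have pos_adj : ∀ b j, j < L → G.Adj (pos b j) (pos b (j + 1)) := by
    rintro (_ | a) j hj
    · have h := (hT.iterate_par (x := v) (j := j) (by omega)).2
      have := hT.adj_par (x := par^[j] v) (hT.ne_root_of_depth_pos (by omega))
      simp only [pos, Function.iterate_succ_apply']
      exact this.symm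
    · have := hT.adj_par (x := par^[L - (j + 1)] (w a))
        (hT.ne_root_of_depth_pos (by rw [pos_depth a _ hj]; omega))
      rw [← Function.iterate_succ_apply' par, show (L - (j + 1)).succ = L - j by omega] at this
      exact this
  have pos_dist : ∀ p b j, j < L → ¬ hit p b →
      G.dist p (pos b (j + 1)) = G.dist p v + (j + 1) := by
    rintro p (_ | a) j hj hp
    · have hp' : Below root par v p := not_not.1 hp
      have h := hT.iterate_par (x := v) (j := j + 1) (by omega)
      have h1 := hT.dist_add_depth hp'
      have h2 := hT.dist_add_depth (h.1.trans hp')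
      have := h.2
      rw [SimpleGraph.dist_comm] at h1 h2
      simp only [pos]
      omega
    · have := hT.dist_add_depth_par (top_ne a) hp (below_top a j hj)
      rw [pos_depth a _ hj, top_par] at this
      simp only [pos]
      omega
  have pos_ne : ∀ b b' j, j < L → b ≠ b' → pos b (j + 1) ≠ pos b' (j + 1) := by
    have up_ne : ∀ a j, j < L → par^[j + 1] v ≠ par^[L - (j + 1)] (w a) := by
      intro a j hj h
      have h1 := pos_depth a (j + 1) hj
      have := (hT.iterate_par (x := v) (j := j + 1) (by omega)).2
      rw [h] at this
      omega
    rintro (_ | a) (_ | a') j hj hne h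
    · exact hne rfl
    · exact up_ne a' j hj h
    · exact up_ne a j hj h.symm
    · refine hne (congrArg some (hinj (hT.below_unique (below_top a j hj) ?_
        (by rw [top_depth, top_depth]))))
      have h' : par^[L - (j + 1)] (w a) = par^[L - (j + 1)] (w a') := h
      rw [h']
      exact below_top a' j hj
  have pos_zero : ∀ b, pos b 0 = v := by
    rintro (_ | a)
    · rfl
    · exact (hw a).2.1
  -- Only one path leads up, so of two paths that are not hit one leads down, and back to `A`.
  obtain ⟨a, b', hne, ha, hb⟩ : ∃ (a : Fin m) (b' : Option (Fin m)), some a ≠ b' ∧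
      (∀ c : Fin L × ι, ¬ hit (q c.1 c.2) (some a)) ∧ ∀ c : Fin L × ι, ¬ hit (q c.1 c.2) b' := by
    obtain ⟨b, b', hne, hb, hb'⟩ := exists_two_not_hit
      (fun (c : Fin L × ι) b => hit (q c.1 c.2) b) (fun c => hit_uniq _) (by
        rw [Fintype.card_prod, Fintype.card_fin, Fintype.card_option, Fintype.card_fin]; omega)
    rcases b with _ | a
    · rcases b' with _ | a
      · exact absurd rfl hne
      · exact ⟨a, none, hne.symm, hb', hb⟩
    · exact ⟨a, b', hne, hb, hb'⟩
  refine ⟨pos (some a), pos b', pos_zero (some a), pos_zero b', ?_, fun j hj =>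
    ⟨pos_adj (some a) j hj, pos_adj b' j hj, pos_ne (some a) b' j hj hne, fun i =>
      ⟨pos_dist (q j i) (some a) j hj (ha (⟨j, hj⟩, i)),
        pos_dist (q j i) b' j hj (hb (⟨j, hj⟩, i))⟩⟩⟩
  simp only [pos, Nat.sub_self]
  exact (hw a).1

/-- The vertices below the hub `v`, at most `D` below it, outside of the first `e` branches. -/
def hubSet (root : V) (par : V → V) (depth idx : V → ℕ) (v : V) (e D : ℕ) : Set V :=
  {x | Below root par v x ∧ (∀ u, u ≠ root → par u = v → idx u < e → ¬ Below root par u x) ∧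
    depth x ≤ depth v + D}

/-- If each hub has `n * (n - 1) + 1` branches, each of which is a path of length `n` to the next
hub, then `n` cops win. -/
theorem IsRootedAt.copsWin (hT : IsRootedAt G root par depth) {n : ℕ} (hn : 2 ≤ n)
    (Hub : V → Prop) (idx : V → ℕ) (hroot : Hub root)
    (hidx : ∀ v, Hub v → ∀ a < n * (n - 1) + 1, ∃ u, u ≠ root ∧ par u = v ∧ idx u = a)
    (hlt : ∀ u, u ≠ root → Hub (par u) → idx u < n * (n - 1) + 1)
    (hinj : ∀ u u', u ≠ root → u' ≠ root → Hub (par u) → par u = par u' → idx u = idx u' → u = u')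
    (hnext : ∀ u, u ≠ root → Hub (par u) → ∃ w, Hub w ∧ depth w = depth (par u) + n ∧
      ∀ x, Below root par u x → Below root par x w ∨ Below root par w x) :
    CopsWin G (Fin n) := by
  -- `j` counts the groups of `n` branches already excluded, and `e` the rounds left after the
  -- present one. The bound `M + j` allows for one level gained per round.
  have main : ∀ M v, Hub v → ∀ e j, j + e + 2 = n → ∃ σ : CopStrategy V (Fin n),
      WinsFrom G σ (hubSet root par depth idx v (n * j) (M + j)) := by
    intro M
    induction M using Nat.strong_induction_on with
    | _ M ihM =>
    intro v hv e
    induction e with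
    | zero => ?_
    | succ e ihe => ?_
    -- The cases `e = 0` and `e + 1` differ only when no probed branch contains the robber: then
    -- either one branch is left, or the next group is probed.
    all_goals
      intro j hj
      have hmul : n * (j + 1) = n * j + n := Nat.mul_succ n j
      have hle : n * (j + 1) ≤ n * (n - 1) := Nat.mul_le_mul_left n (by omega)
      have hp : ∀ i : Fin n, ∃ u, u ≠ root ∧ par u = v ∧ idx u = n * j + i := fun i =>
        hidx v hv _ (by have := i.2; omega)
      choose p hpr hpv hpi using hp
      have hpd : ∀ i, depth (p i) = depth v + 1 := fun i => by rw [hT.depth_eq _ (hpr i), hpv]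
      refine exists_winsFrom_of_probe p fun d hd => ?_
      set S := answerSet G p d (hubSet root par depth idx v (n * j) (M + j)) with hS
      have dist_in : ∀ x ∈ S, ∀ i, Below root par (p i) x → d i + depth v + 1 = depth x := by
        intro x hx i hi
        have h1 : G.dist (p i) x = d i := congrFun hx.2 i
        have h2 := hT.dist_add_depth hi
        have := hpd i
        omega
      have dist_out : ∀ x ∈ S, ∀ i, ¬ Below root par (p i) x → d i + depth v = depth x + 1 := by
        intro x hx i hi
        have h1 : G.dist (p i) x = d i := congrFun hx.2 i
        have h2 := hT.dist_add_depth_par (hpr i) hi .refl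
        rw [hpv i, SimpleGraph.dist_comm, SimpleGraph.dist_comm (u := x)] at h2
        have h3 := hT.dist_add_depth hx.1.1
        have := hpd i
        omega
      have same_branch : ∀ x ∈ S, ∀ y ∈ S, ∀ i, Below root par (p i) x →
          Below root par (p i) y := by
        intro x hx y hy i hi
        by_contra hiy
        -- A single answer cannot separate a shallow robber outside the branch from a deeper one
        -- inside. A second probe does: relative to probe `i`, it returns 2 more if he is in branch
        -- `i`, 2 less if in branch `i'`, and the same if in neither. This uses `2 ≤ n`.
        obtain ⟨i', hne⟩ : ∃ i' : Fin n, i' ≠ i := by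
          have : Nontrivial (Fin n) := Fin.nontrivial_iff_two_le.2 hn
          exact exists_ne i
        have hi' : ¬ Below root par (p i') x := fun h => hne (by
          have h1 := hT.below_unique h hi (by rw [hpd, hpd])
          have h2 := hpi i'
          rw [h1, hpi i] at h2
          exact Fin.ext (by omega))
        have h1 := dist_in x hx i hi
        have h2 := dist_out y hy i hiy
        have h3 := dist_out x hx i' hi'
        by_cases hy' : Below root par (p i') y
        · have := dist_in y hy i' hy'; omega
        · have := dist_out y hy i' hy'; omega
      have same_depth : ∀ x ∈ S, ∀ y ∈ S, depth x = depth y := by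
        intro x hx y hy
        by_cases h : Below root par (p ⟨0, by omega⟩) x
        · have h1 := dist_in x hx _ h
          have h2 := dist_in y hy _ (same_branch x hx y hy _ h)
          omega
        · have h1 := dist_out x hx _ h
          have h2 := dist_out y hy _ fun h' => h (same_branch y hy x hx _ h')
          omega
      have ne_hub : ∀ x ∈ S, x ≠ v := by
        rintro x hx rfl
        refine hd fun y hy z hz => ?_
        rw [hT.eq_of_below hy.1.1 (same_depth y hy x hx).le,
          hT.eq_of_below hz.1.1 (same_depth z hz x hx).le]
      obtain ⟨x₀, hx₀⟩ : S.Nonempty := by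
        rw [Set.nonempty_iff_ne_empty]
        intro h
        exact hd (by rw [h]; exact Set.subsingleton_empty)
      have one_branch : ∀ u, u ≠ root → par u = v → (∀ x ∈ S, Below root par u x) →
          ∃ σ : CopStrategy V (Fin n), WinsFrom G σ (moveSet G S) := by
        intro u hur huv hu
        obtain ⟨w, hw, hwd, hcomp⟩ := hnext u hur (huv ▸ hv)
        rw [huv] at hwd
        -- Down to `w` the branch is a path, so the common depth would already locate the robber.
        have hlong : depth w < depth x₀ := by
          by_contra hcon
          refine hd fun y hy z hz => ?_
          have key : ∀ y ∈ S, Below root par y w := by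
            intro y hy
            rcases hcomp y (hu y hy) with h | h
            · exact h
            · rw [hT.eq_of_below h (by have := same_depth y hy x₀ hx₀; omega)]
              exact .refl
          exact hT.below_unique (key y hy) (key z hz) (same_depth y hy z hz)
        have hD := hx₀.1.2.2
        -- After his move the robber is at most `M + j + 1` levels below `v`, and `j + 1 ≤ n - 1`;
        -- as `w` is `n` levels below `v`, this leaves at most `M - 1` levels below `w`.
        obtain ⟨σ, hσ⟩ := ihM (M - 1) (by omega) w hw (n - 2) 0 (by omega)
        refine ⟨σ, hσ.mono ?_⟩
        rintro z ⟨y, hy, hz⟩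
        have hyd := same_depth y hy x₀ hx₀
        have hwy : Below root par w y := by
          rcases hcomp y (hu y hy) with h | h
          · have := hT.depth_le h; omega
          · exact h
        refine ⟨?_, fun _ _ _ h => absurd h (by omega), ?_⟩
        · rcases hz with rfl | hz
          · exact hwy
          · exact hT.below_of_adj hz hwy (by rintro rfl; omega)
        · have : depth z ≤ depth y + 1 := by
            rcases hz with rfl | hz
            · omega
            · exact hT.depth_le_of_adj hz
          omega
      obtain ⟨u₀, hu₀r, hu₀v, hu₀⟩ := hx₀.1.1.exists_child (ne_hub x₀ hx₀)
      have hge : ∀ u, u ≠ root → par u = v → ∀ x ∈ S, Below root par u x → n * j ≤ idx u :=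
        fun u hur huv x hx hux => not_lt.1 fun h => hx.1.2.1 u hur huv h hux
      have probed : ∀ u, u ≠ root → par u = v → n * j ≤ idx u → idx u < n * (j + 1) →
          ∃ i, u = p i := fun u hur huv h1 h2 => ⟨⟨idx u - n * j, by omega⟩,
            hinj _ _ hur (hpr _) (huv ▸ hv) (by rw [huv, hpv]) (by rw [hpi]; simp only; omega)⟩
      by_cases hsmall : idx u₀ < n * (j + 1)
      · obtain ⟨i, rfl⟩ := probed u₀ hu₀r hu₀v (hge u₀ hu₀r hu₀v x₀ hx₀ hu₀) hsmall
        exact one_branch _ hu₀r hu₀v fun x hx => same_branch x₀ hx₀ x hx i hu₀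
      have out : ∀ x ∈ S, ∀ u, u ≠ root → par u = v → Below root par u x →
          n * (j + 1) ≤ idx u := by
        intro x hx u hur huv hux
        by_contra h
        obtain ⟨i, rfl⟩ := probed u hur huv (hge u hur huv x hx hux) (not_le.1 h)
        refine hsmall ?_
        rw [hT.below_unique hu₀ (same_branch x hx x₀ hx₀ i hux)
          (by rw [hT.depth_eq _ hu₀r, hu₀v, hpd])]
        exact not_le.1 h
    · refine one_branch u₀ hu₀r hu₀v fun x hx => ?_
      obtain ⟨u, hur, huv, hux⟩ := hx.1.1.exists_child (ne_hub x hx)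
      have h1 := out x hx u hur huv hux
      have h2 := out x₀ hx₀ u₀ hu₀r hu₀v hu₀
      have h3 := hlt u hur (huv ▸ hv)
      have h4 := hlt u₀ hu₀r (hu₀v ▸ hv)
      -- In the last round only the index `n * (n - 1)` is left.
      have hjn : n * (j + 1) = n * (n - 1) := by rw [show j + 1 = n - 1 by omega]
      rwa [← hinj u u₀ hur hu₀r (huv ▸ hv) (by rw [huv, hu₀v]) (by omega)]
    · obtain ⟨σ, hσ⟩ := ihe (j + 1) (by omega)
      refine ⟨σ, hσ.mono ?_⟩
      rintro z ⟨y, hy, hz⟩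
      refine ⟨?_, fun u hur huv hlt' hu => ?_, ?_⟩
      · rcases hz with rfl | hz
        · exact hy.1.1
        · exact hT.below_of_adj hz hy.1.1 (ne_hub y hy)
      · have hyu : ¬ Below root par u y := fun h => by have := out y hy u hur huv h; omega
        rcases hz with rfl | hz
        · exact hyu hu
        · exact ne_hub y hy ((hT.eq_of_adj_of_below hz hyu hu).2.1.trans huv)
      · have h1 : depth z ≤ depth y + 1 := by
          rcases hz with rfl | hz
          · omega
          · exact hT.depth_le_of_adj hz
        have := hy.1.2.2
        omega
  obtain ⟨σ, hσ⟩ := exists_winsFrom_of_probe (G := G) (S := Set.univ) (fun _ : Fin n => root)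
    fun d _ => by
      obtain ⟨σ, hσ⟩ := main (d ⟨0, by omega⟩ + 1) root hroot (n - 2) 0 (by omega)
      refine ⟨σ, hσ.mono ?_⟩
      rintro z ⟨y, hy, hz⟩
      refine ⟨hT.root_below z, fun _ _ _ h => absurd h (by omega), ?_⟩
      have h1 : depth z ≤ depth y + 1 := by
        rcases hz with rfl | hz
        · omega
        · exact hT.depth_le_of_adj hz
      have h2 : G.dist root y = d ⟨0, by omega⟩ := congrFun hy.2 _
      have h3 := hT.dist_add_depth (hT.root_below y)
      omega
  exact hσ.copsWin

end Bounds

/-! ### The ray, `T_ω` and `S(n)` -/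

section Examples

variable {c : ℕ → ℕ} {k : ℕ}

theorem ray_isRootedAt : IsRootedAt ray 0 Nat.pred id where
  depth_root := rfl
  depth_eq x hx := (Nat.succ_pred hx).symm
  adj_iff x y := by
    rw [ray, SimpleGraph.fromRel_adj]
    simp only [Nat.pred_eq_sub_one]
    omega

theorem ray_isLocallyFiniteTree : IsLocallyFiniteTree ray :=
  ray_isRootedAt.isLocallyFiniteTree fun v => (Set.finite_singleton (v + 1)).subset (by
    rintro u ⟨hu, rfl⟩
    exact (Nat.succ_pred hu).symm)

theorem ray_copsWin : CopsWin ray PUnit := by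
  obtain ⟨σ, hσ⟩ := exists_winsFrom_of_probe (G := ray) (S := Set.univ) (fun _ : PUnit => 0)
    fun d hd => by
      refine absurd (fun x hx y hy => ?_) hd
      have h : ray.dist 0 x = ray.dist 0 y := congrFun (hx.2.trans hy.2.symm) PUnit.unit
      have h1 := ray_isRootedAt.dist_add_depth (ray_isRootedAt.root_below x)
      have h2 := ray_isRootedAt.dist_add_depth (ray_isRootedAt.root_below y)
      simp only [id] at h1 h2
      omega
  exact hσ.copsWin

theorem localizationNumber_ray : localizationNumber ray = 1 :=
  localizationNumber_eq (ι := PUnit) Cardinal.mk_punit ray_copsWin fun _ h =>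
    Cardinal.one_le_iff_ne_zero.2 (Cardinal.mk_ne_zero_iff.2 h.nonempty)

theorem IsAddress.tail {l : List ℕ} (h : IsAddress c l) : IsAddress c l.tail := by
  cases l with
  | nil => trivial
  | cons a l => exact h.2

theorem isAddress_replicate (hc : ∀ i, 0 < c i) (i : ℕ) : IsAddress c (List.replicate i 0) := by
  induction i with
  | zero => trivial
  | succ i ih => exact ⟨hc _, ih⟩

/-- The parent of a vertex of `rootedTree c`. -/
def addressParent (x : {l : List ℕ // IsAddress c l}) : {l : List ℕ // IsAddress c l} :=
  ⟨x.1.tail, x.2.tail⟩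

theorem rootedTree_isRootedAt :
    IsRootedAt (rootedTree c) ⟨[], trivial⟩ addressParent (fun x => x.1.length) where
  depth_root := rfl
  depth_eq := by
    rintro ⟨_ | ⟨a, l⟩, h⟩ hx
    · exact absurd rfl hx
    · rfl
  adj_iff := by
    have key : ∀ x y : {l : List ℕ // IsAddress c l}, (∃ a : ℕ, x.1 = a :: y.1) ↔
        x ≠ ⟨[], trivial⟩ ∧ addressParent x = y := by
      rintro ⟨_ | ⟨a, l⟩, hx⟩ ⟨m, hy⟩
      · simp
      · simp [addressParent, Subtype.ext_iff]
    intro x y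
    rw [rootedTree, SimpleGraph.fromRel_adj, key, key]
    refine ⟨fun h => h.2, fun h => ⟨?_, h⟩⟩
    rintro rfl
    rw [← key, or_self] at h
    obtain ⟨a, ha⟩ := h
    exact List.cons_ne_self a _ ha.symm

theorem rootedTree_isLocallyFiniteTree (hc : ∀ i, 0 < c i) :
    IsLocallyFiniteTree (rootedTree c) := by
  have : Infinite {l : List ℕ // IsAddress c l} :=
    Infinite.of_injective (fun i => ⟨List.replicate i 0, isAddress_replicate hc i⟩) fun i j h => by
      simpa using congrArg (fun x : {l : List ℕ // IsAddress c l} => x.1.length) h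
  refine rootedTree_isRootedAt.isLocallyFiniteTree fun v => ?_
  refine Set.Finite.of_injOn (f := Subtype.val) (t := (· :: v.1) '' Set.Iio (c v.1.length)) ?_
    Subtype.val_injective.injOn ((Set.finite_Iio _).image _)
  rintro ⟨_ | ⟨a, l⟩, hu⟩ ⟨hne, rfl⟩
  · exact absurd rfl hne
  · exact ⟨a, hu.1, rfl⟩

theorem treeOmega_not_copsWin (ι : Type*) [Fintype ι] : ¬ CopsWin treeOmega ι := by
  refine (rootedTree_isRootedAt (c := fun i => i + 1)).not_copsWin (L := 1) one_pos
    (m := Fintype.card ι + 1) (by omega) {x | Fintype.card ι + 1 ≤ x.1.length}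
    ⟨⟨List.replicate (Fintype.card ι + 1) 0, isAddress_replicate (fun _ => Nat.succ_pos _) _⟩,
      by simp⟩ ?_
  -- A vertex at depth at least `k + 1` has more than `k + 1` children, enough for the count with `L
  -- = 1`, and the condition on the depth persists downwards.
  rintro ⟨l, hl⟩ (hlen : _ ≤ l.length)
  refine ⟨by simp only; omega, fun a => ⟨a :: l, (by have := a.2; simp only; omega), hl⟩, ?_, ?_⟩
  · intro a b hab
    simpa [addressParent, Fin.ext_iff, Subtype.ext_iff] using hab
  · exact fun a => ⟨Nat.le_succ_of_le hlen, rfl, rfl⟩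

theorem treeOmega_isLocallyFiniteTree : IsLocallyFiniteTree treeOmega :=
  rootedTree_isLocallyFiniteTree fun _ => Nat.succ_pos _

theorem localizationNumber_treeOmega : localizationNumber treeOmega = ℵ₀ := by
  have hT := treeOmega_isLocallyFiniteTree
  have := hT.1
  refine localizationNumber_eq (Cardinal.mk_eq_aleph0 _) (copsWin_self hT.2.1.connected)
    fun ι h => ?_
  rw [Cardinal.aleph0_le_mk_iff]
  by_contra hfin
  rw [not_infinite_iff_finite] at hfin
  have := Fintype.ofFinite ι
  exact treeOmega_not_copsWin ι h

/-! ### Subdivided trees as rooted trees -/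

/-- The root of `subdividedRootedTree c k`. -/
def subdividedRoot : SubdividedVertex c k := ⟨([], 0), trivial, Nat.zero_le _, fun _ => rfl⟩

/-- The original vertex with address `l`. -/
def originalVertex (l : List ℕ) (hl : IsAddress c l) : SubdividedVertex c k :=
  ⟨(l, 0), hl, Nat.zero_le _, fun _ => rfl⟩

/-- The vertex at distance `i` from `a :: l` on the edge between `a :: l` and `l`. -/
def edgeVertex (a : ℕ) (l : List ℕ) (hl : IsAddress c (a :: l)) (i : ℕ) (hi : i ≤ k) :
    SubdividedVertex c k :=
  ⟨(a :: l, i), hl, hi, fun h => absurd h (List.cons_ne_nil _ _)⟩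

/-- The parent of a vertex of `subdividedRootedTree c k`. -/
def subdividedParent (x : SubdividedVertex c k) : SubdividedVertex c k :=
  if h : x.1.2 < k ∧ x.1.1 ≠ [] then ⟨(x.1.1, x.1.2 + 1), x.2.1, h.1, fun h' => absurd h' h.2⟩
  else ⟨(x.1.1.tail, 0), x.2.1.tail, Nat.zero_le _, fun _ => rfl⟩

/-- The distance of a vertex of `subdividedRootedTree c k` from the root. -/
def subdividedDepth (x : SubdividedVertex c k) : ℕ := x.1.1.length * (k + 1) - x.1.2

theorem eq_subdividedRoot_or (x : SubdividedVertex c k) :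
    x = subdividedRoot ∨ ∃ a l hl i hi, x = edgeVertex a l hl i hi := by
  obtain ⟨⟨_ | ⟨a, l⟩, i⟩, h1, h2, h3⟩ := x
  · obtain rfl : i = 0 := h3 rfl
    exact .inl rfl
  · exact .inr ⟨a, l, h1, i, h2, rfl⟩

theorem edgeVertex_ne_root (a : ℕ) (l : List ℕ) (hl : IsAddress c (a :: l)) (i : ℕ) (hi : i ≤ k) :
    edgeVertex a l hl i hi ≠ subdividedRoot := fun h =>
  List.cons_ne_nil a l (congrArg (fun x : SubdividedVertex c k => x.1.1) h)

theorem subdividedParent_edgeVertex_of_lt {a : ℕ} {l : List ℕ} (hl : IsAddress c (a :: l)) {i : ℕ}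
    (hi : i < k) : subdividedParent (edgeVertex a l hl i hi.le) = edgeVertex a l hl (i + 1) hi :=
  dif_pos ⟨hi, List.cons_ne_nil _ _⟩

theorem subdividedParent_edgeVertex_last {a : ℕ} {l : List ℕ} (hl : IsAddress c (a :: l)) :
    subdividedParent (edgeVertex a l hl k le_rfl) = originalVertex l hl.2 :=
  dif_neg fun h => lt_irrefl _ h.1

theorem subdividedRootedTree_isRootedAt :
    IsRootedAt (subdividedRootedTree c k) subdividedRoot subdividedParent subdividedDepth where
  depth_root := by simp [subdividedDepth, subdividedRoot]
  depth_eq x hx := by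
    rcases eq_subdividedRoot_or x with rfl | ⟨a, l, hl, i, hi, rfl⟩
    · exact absurd rfl hx
    rcases hi.lt_or_eq with h | rfl
    · rw [subdividedParent_edgeVertex_of_lt hl h]
      simp only [subdividedDepth, edgeVertex, List.length_cons, Nat.add_mul]
      omega
    · rw [subdividedParent_edgeVertex_last]
      simp only [subdividedDepth, edgeVertex, originalVertex, List.length_cons, Nat.add_mul]
      omega
  adj_iff := by
    have key : ∀ x y : SubdividedVertex c k, ((y.1.1 = x.1.1 ∧ y.1.2 = x.1.2 + 1) ∨
        (x.1.2 = k ∧ y.1.2 = 0 ∧ ∃ a : ℕ, x.1.1 = a :: y.1.1)) ↔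
        x ≠ subdividedRoot ∧ subdividedParent x = y := by
      intro x y
      rcases eq_subdividedRoot_or x with rfl | ⟨a, l, hl, i, hi, rfl⟩
      · have := y.2.2.2
        simp only [subdividedRoot, ne_eq, not_true_eq_false, false_and, iff_false]
        rintro (⟨h1, h2⟩ | ⟨-, -, a, h⟩)
        · have := this h1; omega
        · simp at h
      · simp only [edgeVertex_ne_root, ne_eq, not_false_eq_true, true_and]
        obtain ⟨⟨m, j⟩, hy⟩ := y
        rcases hi.lt_or_eq with h | rfl
        · rw [subdividedParent_edgeVertex_of_lt hl h]
          simp only [edgeVertex, Subtype.mk.injEq, Prod.mk.injEq]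
          constructor
          · rintro (⟨h1, h2⟩ | ⟨h1, -⟩)
            · exact ⟨h1.symm, h2.symm⟩
            · omega
          · rintro ⟨h1, h2⟩
            exact .inl ⟨h1.symm, h2.symm⟩
        · rw [subdividedParent_edgeVertex_last]
          simp only [edgeVertex, originalVertex, Subtype.mk.injEq, Prod.mk.injEq, List.cons.injEq]
          constructor
          · rintro (⟨-, h2⟩ | ⟨-, h1, b, -, h2⟩)
            · have := hy.2.1; simp only at this; omega
            · exact ⟨h2, h1.symm⟩
          · rintro ⟨h1, h2⟩
            exact .inr ⟨trivial, h2.symm, a, rfl, h1⟩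
    intro x y
    rw [subdividedRootedTree, SimpleGraph.fromRel_adj, key, key]
    refine ⟨fun h => h.2, fun h => ⟨?_, h⟩⟩
    rintro rfl
    rw [← key, or_self] at h
    rcases h with ⟨-, h⟩ | ⟨-, -, a, h⟩
    · omega
    · exact List.cons_ne_self a _ h.symm

theorem originalVertex_eq_edgeVertex {a : ℕ} {l : List ℕ} (hl : IsAddress c (a :: l)) :
    (originalVertex (a :: l) hl : SubdividedVertex c k) = edgeVertex a l hl 0 (Nat.zero_le _) := rfl

/-- The children of an original vertex are the last vertices of the edges below it. -/
theorem eq_edgeVertex_of_subdividedParent {u : SubdividedVertex c k} {l : List ℕ}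
    {hl : IsAddress c l} (hu : u ≠ subdividedRoot)
    (h : subdividedParent u = originalVertex l hl) :
    ∃ (a : ℕ) (ha : IsAddress c (a :: l)), u = edgeVertex a l ha k le_rfl := by
  rcases eq_subdividedRoot_or u with rfl | ⟨a, m, hm, i, hi, rfl⟩
  · exact absurd rfl hu
  rcases hi.lt_or_eq with h' | rfl
  · rw [subdividedParent_edgeVertex_of_lt hm h'] at h
    exact absurd (congrArg (fun x : SubdividedVertex c k => x.1.2) h) (Nat.succ_ne_zero _)
  · rw [subdividedParent_edgeVertex_last] at h
    obtain rfl : m = l := congrArg (fun x : SubdividedVertex c _ => x.1.1) h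
    exact ⟨a, hm, rfl⟩

theorem subdividedRootedTree_isLocallyFiniteTree (hc : ∀ i, 0 < c i) :
    IsLocallyFiniteTree (subdividedRootedTree c k) := by
  have : Infinite (SubdividedVertex c k) :=
    Infinite.of_injective (fun i => originalVertex _ (isAddress_replicate hc i)) fun i j h => by
      simpa [originalVertex] using congrArg (fun x : SubdividedVertex c k => x.1.1.length) h
  refine subdividedRootedTree_isRootedAt.isLocallyFiniteTree fun v => ?_
  refine Set.Finite.of_injOn (f := Subtype.val)
    (t := (v.1.1, ·) '' Set.Iic k ∪ (fun a => (a :: v.1.1, k)) '' Set.Iio (c v.1.1.length)) ?_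
    Subtype.val_injective.injOn
    (((Set.finite_Iic _).image _).union ((Set.finite_Iio _).image _))
  rintro u ⟨hne, rfl⟩
  rcases eq_subdividedRoot_or u with rfl | ⟨a, l, hl, i, hi, rfl⟩
  · exact absurd rfl hne
  rcases hi.lt_or_eq with h | rfl
  · rw [subdividedParent_edgeVertex_of_lt hl h]
    exact .inl ⟨i, hi, rfl⟩
  · rw [subdividedParent_edgeVertex_last]
    exact .inr ⟨a, hl.1, rfl⟩

theorem iterate_subdividedParent {a : ℕ} {l : List ℕ} (hl : IsAddress c (a :: l)) {i : ℕ}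
    (hi : i ≤ k) : subdividedParent^[i] (originalVertex (a :: l) hl) = edgeVertex a l hl i hi := by
  induction i with
  | zero => rfl
  | succ i ih =>
    rw [Function.iterate_succ_apply', ih (by omega), subdividedParent_edgeVertex_of_lt hl hi]

theorem below_edgeVertex_zero {a : ℕ} {l : List ℕ} (hl : IsAddress c (a :: l)) {i : ℕ}
    (hi : i ≤ k) : Below subdividedRoot subdividedParent (edgeVertex a l hl i hi)
      (edgeVertex a l hl 0 (Nat.zero_le _)) := by
  rw [← iterate_subdividedParent hl hi, ← originalVertex_eq_edgeVertex]
  refine (subdividedRootedTree_isRootedAt.iterate_par ?_).1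
  simp only [subdividedDepth, originalVertex, List.length_cons, Nat.add_mul]
  omega

/-- A vertex on or below an edge is an ancestor or a descendant of the lower end of the edge. -/
theorem below_or_below_of_below_edgeVertex {a : ℕ} {l : List ℕ} (hl : IsAddress c (a :: l))
    {x : SubdividedVertex c k}
    (h : Below subdividedRoot subdividedParent (edgeVertex a l hl k le_rfl) x) :
    Below subdividedRoot subdividedParent x (originalVertex (a :: l) hl) ∨
      Below subdividedRoot subdividedParent (originalVertex (a :: l) hl) x := by
  have key : (∃ i hi, x = edgeVertex a l hl i hi) ∨
      Below subdividedRoot subdividedParent (originalVertex (a :: l) hl) x := by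
    induction h with
    | refl => exact .inl ⟨k, le_rfl, rfl⟩
    | @child x hx _ ih =>
      rcases ih with ⟨i, hi, h⟩ | h
      · rcases i with _ | i
        · exact .inr (.child hx (h ▸ .refl))
        · left
          rcases eq_subdividedRoot_or x with rfl | ⟨b, m, hm, j, hj, rfl⟩
          · exact absurd rfl hx
          rcases hj.lt_or_eq with hj' | rfl
          · rw [subdividedParent_edgeVertex_of_lt hm hj'] at h
            obtain ⟨rfl, rfl⟩ : b = a ∧ m = l := by
              simpa [edgeVertex] using congrArg (fun x : SubdividedVertex c k => x.1.1) h
            exact ⟨j, hj, rfl⟩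
          · rw [subdividedParent_edgeVertex_last] at h
            exact absurd (congrArg (fun x : SubdividedVertex c _ => x.1.2) h).symm
              (Nat.succ_ne_zero _)
      · exact .inr (.child hx h)
  refine key.imp_left ?_
  rintro ⟨i, hi, rfl⟩
  exact below_edgeVertex_zero hl hi

/-! ### The localization number of `S(n)` -/

theorem treeS_copsWin {n : ℕ} (hn : 2 ≤ n) : CopsWin (treeS n) (Fin n) := by
  refine (subdividedRootedTree_isRootedAt (c := fun _ => n * (n - 1) + 1) (k := n - 1)).copsWin hn
    (fun v => v.1.2 = 0) (fun u => u.1.1.headD 0) rfl ?_ ?_ ?_ ?_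
  · rintro ⟨⟨l, i⟩, hl, hi, h⟩ hv a ha
    obtain rfl : i = 0 := hv
    exact ⟨edgeVertex a l ⟨ha, hl⟩ _ le_rfl, edgeVertex_ne_root _ _ _ _ _,
      subdividedParent_edgeVertex_last _, rfl⟩
  · intro u hu _
    rcases eq_subdividedRoot_or u with rfl | ⟨a, l, hl, i, hi, rfl⟩
    · exact absurd rfl hu
    · exact hl.1
  · intro u u' hu hu' hv hp hidx
    obtain ⟨⟨⟨l, i⟩, hl, hi, h⟩, hv'⟩ : ∃ v, v = subdividedParent u := ⟨_, rfl⟩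
    obtain rfl : i = 0 := by rwa [← hv'] at hv
    obtain ⟨a, ha, rfl⟩ := eq_edgeVertex_of_subdividedParent (l := l) (hl := hl) hu hv'.symm
    obtain ⟨b, hb, rfl⟩ := eq_edgeVertex_of_subdividedParent (l := l) (hl := hl) hu'
      (hp.symm.trans hv'.symm)
    obtain rfl : a = b := hidx
    rfl
  · intro u hu hv
    obtain ⟨⟨⟨l, i⟩, hl, hi, h⟩, hv'⟩ : ∃ v, v = subdividedParent u := ⟨_, rfl⟩
    obtain rfl : i = 0 := by rwa [← hv'] at hv
    obtain ⟨a, ha, rfl⟩ := eq_edgeVertex_of_subdividedParent (l := l) (hl := hl) hu hv'.symm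
    refine ⟨originalVertex (a :: l) ha, rfl, ?_, fun x => below_or_below_of_below_edgeVertex ha⟩
    rw [subdividedParent_edgeVertex_last]
    simp only [subdividedDepth, originalVertex, List.length_cons, Nat.add_mul]
    omega

theorem treeS_not_copsWin {n : ℕ} (hn : 2 ≤ n) {ι : Type*} [Fintype ι] (hι : Fintype.card ι < n) :
    ¬ CopsWin (treeS n) ι := by
  refine (subdividedRootedTree_isRootedAt (c := fun _ => n * (n - 1) + 1) (k := n - 1)).not_copsWin
    (L := n) (m := n * (n - 1) + 1) (by omega)
    (Nat.succ_le_succ (Nat.mul_le_mul_left n (by omega)))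
    -- The root is left out because the path of length `n` towards the root must exist: it is the
    -- additional branch that makes the count suffice for `n - 1` cops.
    {v | v.1.2 = 0 ∧ v.1.1 ≠ []}
    ⟨originalVertex [0] ⟨Nat.succ_pos _, trivial⟩, rfl, List.cons_ne_nil _ _⟩ ?_
  rintro ⟨⟨l, i⟩, hl, hi, h⟩ ⟨h0, hne⟩
  obtain rfl : i = 0 := h0
  refine ⟨?_, fun a => originalVertex (a :: l) ⟨a.2, hl⟩, fun a b hab => ?_, fun a =>
    ⟨⟨rfl, List.cons_ne_nil _ _⟩, ?_, ?_⟩⟩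
  · have h1 : 1 ≤ l.length := List.length_pos_iff.2 hne
    have := Nat.mul_le_mul_right (n - 1 + 1) h1
    simp only [subdividedDepth]
    omega
  · replace hab := (iterate_subdividedParent (i := n - 1) ⟨a.2, hl⟩ le_rfl).symm.trans
      (hab.trans (iterate_subdividedParent ⟨b.2, hl⟩ le_rfl))
    simpa [edgeVertex, Fin.ext_iff] using congrArg (fun x => x.1.1) hab
  · obtain ⟨n, rfl⟩ : ∃ n', n = n' + 1 := ⟨n - 1, by omega⟩
    rw [Function.iterate_succ_apply']
    exact (congrArg _ (iterate_subdividedParent _ le_rfl)).trans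
      (subdividedParent_edgeVertex_last _)
  · simp only [subdividedDepth, originalVertex, List.length_cons, Nat.add_mul]
    omega

theorem treeS_isLocallyFiniteTree (n : ℕ) : IsLocallyFiniteTree (treeS n) :=
  subdividedRootedTree_isLocallyFiniteTree fun _ => Nat.succ_pos _

theorem localizationNumber_treeS {n : ℕ} (hn : 2 ≤ n) : localizationNumber (treeS n) = n := by
  refine localizationNumber_eq (Cardinal.mk_fin n) (treeS_copsWin hn) fun ι h => ?_
  by_contra hlt
  rw [not_le] at hlt
  have := Cardinal.lt_aleph0_iff_finite.1 (hlt.trans Cardinal.natCast_lt_aleph0)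
  have := Fintype.ofFinite ι
  rw [Cardinal.mk_fintype, Nat.cast_lt] at hlt
  exact treeS_not_copsWin hn hlt h

end Examples

end LocGame

theorem theorem2p3 :
    (∀ κ : Cardinal.{0}, ((∃ n : ℕ, 1 ≤ n ∧ κ = (n : Cardinal.{0})) ∨ κ = Cardinal.aleph0) →
      ∃ (V : Type) (T : SimpleGraph V),
        LocGame.IsLocallyFiniteTree T ∧ LocGame.localizationNumber T = κ) ∧
    (LocGame.IsLocallyFiniteTree LocGame.ray ∧ LocGame.localizationNumber LocGame.ray = 1) ∧
    (∀ n : ℕ, 2 ≤ n →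
      LocGame.IsLocallyFiniteTree (LocGame.treeS n) ∧
        LocGame.localizationNumber (LocGame.treeS n) = (n : Cardinal.{0})) ∧
    (LocGame.IsLocallyFiniteTree LocGame.treeOmega ∧
      LocGame.localizationNumber LocGame.treeOmega = Cardinal.aleph0) := by
  have hS : ∀ n : ℕ, 2 ≤ n → LocGame.IsLocallyFiniteTree (LocGame.treeS n) ∧
      LocGame.localizationNumber (LocGame.treeS n) = (n : Cardinal.{0}) := fun n hn =>
    ⟨LocGame.treeS_isLocallyFiniteTree n, LocGame.localizationNumber_treeS hn⟩
  have hR := And.intro LocGame.ray_isLocallyFiniteTree LocGame.localizationNumber_ray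
  have hO := And.intro LocGame.treeOmega_isLocallyFiniteTree LocGame.localizationNumber_treeOmega
  refine ⟨?_, hR, hS, hO⟩
  rintro κ (⟨n, hn, rfl⟩ | rfl)
  · rcases hn.eq_or_lt with rfl | hn
    · exact ⟨ℕ, LocGame.ray, by simpa using hR⟩
    · exact ⟨_, _, hS n hn⟩
  · exact ⟨_, _, hO⟩
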